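/- \textbf{Setting.} Consider $N$ agents with \[ \dot x_i=A_ix_i+B_iu_i+E_i\omega,\qquad y_i=C_ix_i+D_iu_i,\qquad e_i=y_i-y_0,\qquad y_0=R\omega ,\qquad t\ge 0, \] where $x_i(t)\in\mathbb R^{n_i}$, $u_i(t)\in\mathbb R^{m_i}$, $y_i(t)\in\mathbb R^{p}$, the dimensions $n_i,m_i$ may differ between agents, all matrices are real and constant, and $\omega:[0,\infty)\to\mathbb R^q$ is the (continuous) trajectory of an exosystem whose dynamics need not be known. The followers communicate over a fixed weighted directed graph without self-loops: $a_{ij}>0$ if there is an edge from agent $j$ to agent $i$, and $a_{ij}=0$ otherwise; $a_{ii}=0$. In the augmented graph, which also contains a leader node, there is an edge from the leader to agent $i$ with weight $k_i>0$ if $i$ observes the leader, and $k_i=0$ otherwise; no edge ends at the leader. Let $N_i=\{j: a_{ij}>0\}$, $d_i=\sum_{j\in N_i}a_{ij}$, and \[ e_{\mathrm vi}=\frac1{d_i+k_i}\Big[\sum_{j\in N_i}a_{ij}(y_i-y_j)+k_i(y_i-y_0)\Big]. \] The distributed dynamic state feedback law is \[ u_i=K_{1i}x_i+K_{2i}z_i,\qquad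 \dot z_i=G_{1i}z_i+G_{2i}e_{\mathrm vi}. \] Let $A,B,C,D,K_1,K_2,G_1,G_2$ be the block-diagonal matrices with blocks $A_i,B_i,C_i,D_i,K_{1i},K_{2i},G_{1i},G_{2i}$, let $\mathcal A=[a_{ij}]$, $\mathcal F=\mathrm{diag}\big(\tfrac1{d_1+k_1},\dots,\tfrac1{d_N+k_N}\big)$, $\mathcal W=(I_N-\mathcal F\mathcal A)\otimes I_p$, and \[ A_{\mathrm g}=\begin{bmatrix}A+BK_1 & BK_2\\ G_2\mathcal W(C+DK_1) & G_1+G_2\mathcal WDK_2\end{bmatrix}. \] \textbf{Theorem 1.} Let $A_0\in\mathbb R^{q\times q}$ and suppose that \begin{itemize} \item[(1)] $A_0$ has no eigenvalue with negative real part; \item[(2)] $\dot\omega$ is piecewise continuous on $[0,\infty)$ and there is $\kappa>0$ with $\|A_0\omega(t)-\dot\omega(t)\|_2\le\kappa$ for all $t\ge0$; \item[(3)] the augmented graph has a spanning tree rooted at the leader, that is, there are directed paths from the leader to all other nodes; \item[(4)] for every $i$, $(G_{1i},G_{2i})$ is a $p$-copy internal model of $A_0$: $G_{1i}=\mathrm{diag}(\beta_1,\dots,\beta_p)$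 and $G_{2i}=\mathrm{diag}(\sigma_1,\dots,\sigma_p)$ (the blocks may depend on $i$), where for every $l$ the matrix $\beta_l$ is real and square of some size $s_l$, $\sigma_l\in\mathbb R^{s_l}$, the pair $(\beta_l,\sigma_l)$ is controllable, and the characteristic polynomial of $\beta_l$ is the minimal polynomial of $A_0$. \end{itemize} If $A_{\mathrm g}$ is Hurwitz (all its eigenvalues have negative real parts), then the distributed dynamic state feedback law solves the generalized cooperative output regulation problem, that is: \begin{itemize} \item[a)] the closed-loop system matrix $A_{\mathrm g}$ is Hurwitz; \item[b)] there is $b>0$ such that for every initial condition $(x_i(0),z_i(0))_{i}$ of the closed-loop system there is $T\ge0$ with $\|e_i(t)\|_2\le b$ for all $t\ge T$ and all $i$; \item[c)] if $A_0\omega(t)-\dot\omega(t)\to0$ as $t\to\infty$, then for every initial condition of the closed-loop system $e_i(t)\to0$ as $t\to\infty$ for all $i$. \end{itemize} -/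

import Mathlib

open Set Filter Topology
open scoped Matrix Kronecker

noncomputable section

namespace CoopReg

/-! ### Communication graph -/

/-- A weighted directed graph on the followers `0, …, N-1` together with the edges from the leader.
`a i j > 0` means that there is an edge from follower `j` to follower `i` (and `a i j = 0` that there
is none); `k i > 0` means that there is an edge from the leader to follower `i` (and `k i = 0` that
there is none). There are no self loops. -/
structure AugmentedDigraph (N : ℕ) where
  a : Matrix (Fin N) (Fin N) ℝ
  a_nonneg : ∀ i j, 0 ≤ a i j
  a_diag : ∀ i, a i i = 0
  k : Fin N → ℝ
  k_nonneg : ∀ i, 0 ≤ k i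

namespace AugmentedDigraph

variable {N : ℕ}

/-- The augmented directed graph: `none` is the leader, `some i` is follower `i`. -/
def toDigraph (g : AugmentedDigraph N) : Digraph (Option (Fin N)) where
  Adj v w :=
    match v, w with
    | some j, some i => 0 < g.a i j
    | none, some i => 0 < g.k i
    | _, none => False

/-- There is a spanning tree rooted at the leader: the leader has directed paths to all other
nodes. -/
def HasSpanningTreeFromLeader (g : AugmentedDigraph N) : Prop :=
  ∀ v : Option (Fin N), v ≠ none → Relation.TransGen g.toDigraph.Adj none v

/-- The neighbors of follower `i` among the followers. -/
def nbrs (g : AugmentedDigraph N) (i : Fin N) : Finset (Fin N) :=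
  Finset.univ.filter fun j => 0 < g.a i j

/-- The in-degree of follower `i` (edges from the leader are not counted). -/
def d (g : AugmentedDigraph N) (i : Fin N) : ℝ := ∑ j ∈ g.nbrs i, g.a i j

/-- The diagonal matrix with entries `1 / (d i + k i)`. -/
def F (g : AugmentedDigraph N) : Matrix (Fin N) (Fin N) ℝ :=
  Matrix.diagonal fun i => 1 / (g.d i + g.k i)

/-- The matrix `(I - F 𝒜) ⊗ I_p`, indexed by pairs (follower, output coordinate). -/
def W (g : AugmentedDigraph N) (p : ℕ) :
    Matrix (Σ _ : Fin N, Fin p) (Σ _ : Fin N, Fin p) ℝ :=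
  ((1 - g.F * g.a) ⊗ₖ (1 : Matrix (Fin p) (Fin p) ℝ)).submatrix
    (Equiv.sigmaEquivProd (Fin N) (Fin p)) (Equiv.sigmaEquivProd (Fin N) (Fin p))

end AugmentedDigraph

/-! ### Matrix notions -/

/-- All (complex) eigenvalues of the real matrix `M` have negative real parts. -/
def IsHurwitz {ι : Type*} [Fintype ι] [DecidableEq ι] (M : Matrix ι ι ℝ) : Prop :=
  ∀ μ ∈ spectrum ℂ (M.map (algebraMap ℝ ℂ)), μ.re < 0

/-- No (complex) eigenvalue of the real matrix `M` has negative real part. -/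
def NoStableEigenvalue {ι : Type*} [Fintype ι] [DecidableEq ι] (M : Matrix ι ι ℝ) : Prop :=
  ∀ μ ∈ spectrum ℂ (M.map (algebraMap ℝ ℂ)), 0 ≤ μ.re

/-- The single-input pair `(β, σ)` is controllable: `[σ, βσ, …, β^(s-1)σ]` has rank `s`. -/
def IsControllablePair {s : ℕ} (β : Matrix (Fin s) (Fin s) ℝ) (σ : Fin s → ℝ) : Prop :=
  (Matrix.of fun (r c : Fin s) => ((β ^ (c : ℕ)) *ᵥ σ) r).rank = s

/-- `(G₁, G₂)` is a `p`-copy internal model of `A₀`: `G₁ = diag(β₁, …, β_p)` and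
`G₂ = diag(σ₁, …, σ_p)`, where `(β_l, σ_l)` is a controllable pair with `σ_l` a column and the
characteristic polynomial of `β_l` is the minimal polynomial of `A₀`. -/
def IsInternalModel {p q r : ℕ} (A₀ : Matrix (Fin q) (Fin q) ℝ)
    (G₁ : Matrix (Fin r) (Fin r) ℝ) (G₂ : Matrix (Fin r) (Fin p) ℝ) : Prop :=
  ∃ (s : Fin p → ℕ) (hs : ∑ l, s l = r)
    (β : ∀ l, Matrix (Fin (s l)) (Fin (s l)) ℝ) (σ : ∀ l, Fin (s l) → ℝ),
    (∀ l, IsControllablePair (β l) (σ l) ∧ minpoly ℝ A₀ = (β l).charpoly) ∧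
    G₁ = (Matrix.blockDiagonal' β).reindex
      (finSigmaFinEquiv.trans (finCongr hs)) (finSigmaFinEquiv.trans (finCongr hs)) ∧
    G₂ = (Matrix.of fun (x : Σ l, Fin (s l)) (l : Fin p) =>
        if x.1 = l then σ x.1 x.2 else 0).reindex
      (finSigmaFinEquiv.trans (finCongr hs)) (Equiv.refl (Fin p))

/-! ### The exosystem trajectory -/

/-- `f` is piecewise continuous on `[0, ∞)`: on bounded intervals it has finitely many
discontinuities, and the one-sided limits exist. -/
def PiecewiseContinuous {E : Type*} [TopologicalSpace E] (f : ℝ → E) : Prop :=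
  (∀ T : ℝ, {t ∈ Icc 0 T | ¬ ContinuousWithinAt f (Ici 0) t}.Finite) ∧
  (∀ t, 0 ≤ t → ∃ l, Tendsto f (𝓝[>] t) (𝓝 l)) ∧
  (∀ t, 0 < t → ∃ l, Tendsto f (𝓝[<] t) (𝓝 l))

/-- `dω` is the piecewise continuous time derivative of the continuous function `ω` on `[0, ∞)`;
in each bounded interval, `ω` may fail to be differentiable at finitely many instants (this is
forced by the jumps of `dω`). -/
structure HasPiecewiseContinuousDeriv {q : ℕ} (ω dω : ℝ → Fin q → ℝ) : Prop where
  continuousOn : ContinuousOn ω (Ici 0)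
  hasDeriv : ∃ J : Set ℝ, (∀ T : ℝ, (J ∩ Icc 0 T).Finite) ∧
    ∀ t, 0 ≤ t → t ∉ J → HasDerivWithinAt ω (dω t) (Ici 0) t
  piecewise : PiecewiseContinuous dω

/-- `‖A₀ ω - ω'‖₂` is bounded on `[0, ∞)`, the derivative `dω` of `ω` being piecewise continuous. -/
def BoundedMismatch {q : ℕ} (A₀ : Matrix (Fin q) (Fin q) ℝ) (ω dω : ℝ → Fin q → ℝ) : Prop :=
  HasPiecewiseContinuousDeriv ω dω ∧
  ∃ κ : ℝ, 0 < κ ∧ ∀ t, 0 ≤ t → ‖WithLp.toLp 2 (A₀ *ᵥ ω t - dω t)‖ ≤ κ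

/-! ### Agents, control law, closed loop -/

/-- The data of `N` agents `x_i' = A_i x_i + B_i u_i + E_i ω`, `y_i = C_i x_i + D_i u_i`, and of
the reference `y_0 = R ω`. -/
structure Agents {N : ℕ} (n m : Fin N → ℕ) (p q : ℕ) where
  A : ∀ i, Matrix (Fin (n i)) (Fin (n i)) ℝ
  B : ∀ i, Matrix (Fin (n i)) (Fin (m i)) ℝ
  C : ∀ i, Matrix (Fin p) (Fin (n i)) ℝ
  D : ∀ i, Matrix (Fin p) (Fin (m i)) ℝ
  E : ∀ i, Matrix (Fin (n i)) (Fin q) ℝ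
  R : Matrix (Fin p) (Fin q) ℝ

/-- The gains of the distributed dynamic state feedback law `u_i = K₁_i x_i + K₂_i z_i`,
`z_i' = G₁_i z_i + G₂_i ev_i`. -/
structure StateFeedback {N : ℕ} (n m nz : Fin N → ℕ) (p : ℕ) where
  K₁ : ∀ i, Matrix (Fin (m i)) (Fin (n i)) ℝ
  K₂ : ∀ i, Matrix (Fin (m i)) (Fin (nz i)) ℝ
  G₁ : ∀ i, Matrix (Fin (nz i)) (Fin (nz i)) ℝ
  G₂ : ∀ i, Matrix (Fin (nz i)) (Fin p) ℝ

section ClosedLoop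

variable {N p q : ℕ} {n m nz : Fin N → ℕ}
  (P : Agents n m p q) (g : AugmentedDigraph N) (c : StateFeedback n m nz p)

/-- The input `u_i = K₁_i x_i + K₂_i z_i`. -/
def input (x : ∀ i, Fin (n i) → ℝ) (z : ∀ i, Fin (nz i) → ℝ) (i : Fin N) : Fin (m i) → ℝ :=
  c.K₁ i *ᵥ x i + c.K₂ i *ᵥ z i

/-- The output `y_i = C_i x_i + D_i u_i`. -/
def output (x : ∀ i, Fin (n i) → ℝ) (z : ∀ i, Fin (nz i) → ℝ) (i : Fin N) : Fin p → ℝ :=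
  P.C i *ᵥ x i + P.D i *ᵥ input c x z i

/-- The tracking error `e_i = y_i - y_0`. -/
def trackingError (x : ∀ i, Fin (n i) → ℝ) (z : ∀ i, Fin (nz i) → ℝ) (w : Fin q → ℝ)
    (i : Fin N) : Fin p → ℝ :=
  output P c x z i - P.R *ᵥ w

/-- The local virtual tracking error
`(1 / (d_i + k_i)) (∑_{j ∈ N_i} a_ij (y_i - y_j) + k_i (y_i - y_0))`. -/
def virtualError (x : ∀ i, Fin (n i) → ℝ) (z : ∀ i, Fin (nz i) → ℝ) (w : Fin q → ℝ)
    (i : Fin N) : Fin p → ℝ :=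
  (1 / (g.d i + g.k i)) •
    (∑ j ∈ g.nbrs i, g.a i j • (output P c x z i - output P c x z j) +
      g.k i • (output P c x z i - P.R *ᵥ w))

/-- `(x, z)` is a solution of the closed-loop system on `[0, ∞)` with initial condition
`(x₀, z₀)`. -/
structure IsClosedLoopSolution (ω : ℝ → Fin q → ℝ)
    (x₀ : ∀ i, Fin (n i) → ℝ) (z₀ : ∀ i, Fin (nz i) → ℝ)
    (x : ∀ i, ℝ → Fin (n i) → ℝ) (z : ∀ i, ℝ → Fin (nz i) → ℝ) : Prop where
  x_init : ∀ i, x i 0 = x₀ i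
  z_init : ∀ i, z i 0 = z₀ i
  x_deriv : ∀ i t, 0 ≤ t → HasDerivWithinAt (x i)
    (P.A i *ᵥ x i t + P.B i *ᵥ input c (fun j => x j t) (fun j => z j t) i + P.E i *ᵥ ω t)
    (Ici 0) t
  z_deriv : ∀ i t, 0 ≤ t → HasDerivWithinAt (z i)
    (c.G₁ i *ᵥ z i t + c.G₂ i *ᵥ virtualError P g c (fun j => x j t) (fun j => z j t) (ω t) i)
    (Ici 0) t

/-- The closed-loop system matrix `A_g`, with `A = diag(A_1, …, A_N)` and so on. -/
def closedLoopMatrix :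
    Matrix ((Σ i, Fin (n i)) ⊕ (Σ i, Fin (nz i))) ((Σ i, Fin (n i)) ⊕ (Σ i, Fin (nz i))) ℝ :=
  let A := Matrix.blockDiagonal' P.A
  let B := Matrix.blockDiagonal' P.B
  let C := Matrix.blockDiagonal' P.C
  let D := Matrix.blockDiagonal' P.D
  let K₁ := Matrix.blockDiagonal' c.K₁
  let K₂ := Matrix.blockDiagonal' c.K₂
  let G₁ := Matrix.blockDiagonal' c.G₁
  let G₂ := Matrix.blockDiagonal' c.G₂
  Matrix.fromBlocks
    (A + B * K₁) (B * K₂)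
    (G₂ * g.W p * (C + D * K₁)) (G₁ + G₂ * g.W p * D * K₂)

/-- The control law solves the generalized cooperative output regulation problem:
the closed-loop matrix is Hurwitz; the tracking errors are ultimately bounded with an ultimate bound
`b` that does not depend on the initial condition; and if `A₀ ω - ω' → 0`, then for all initial
conditions all tracking errors tend to zero. -/
structure SolvesOutputRegulation (A₀ : Matrix (Fin q) (Fin q) ℝ) (ω dω : ℝ → Fin q → ℝ) :
    Prop where
  hurwitz : IsHurwitz (closedLoopMatrix P g c)
  ultimatelyBounded : ∃ b : ℝ, 0 < b ∧
    ∀ (x₀ : ∀ i, Fin (n i) → ℝ) (z₀ : ∀ i, Fin (nz i) → ℝ), ∃ T : ℝ, 0 ≤ T ∧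
      ∀ x z, IsClosedLoopSolution P g c ω x₀ z₀ x z → ∀ t, T ≤ t → ∀ i,
        ‖WithLp.toLp 2 (trackingError P c (fun j => x j t) (fun j => z j t) (ω t) i)‖ ≤ b
  tendsto_zero : Tendsto (fun t => A₀ *ᵥ ω t - dω t) atTop (𝓝 0) →
    ∀ (x₀ : ∀ i, Fin (n i) → ℝ) (z₀ : ∀ i, Fin (nz i) → ℝ) x z,
      IsClosedLoopSolution P g c ω x₀ z₀ x z → ∀ i,
        Tendsto (fun t => trackingError P c (fun j => x j t) (fun j => z j t) (ω t) i)
          atTop (𝓝 0)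

end ClosedLoop

end CoopReg

end

/-! Stack all agent and controller states into one vector `ξ`, so that the closed loop reads `ξ' =
A_g ξ + B_g ω` with errors `e = C_g ξ - R_g ω`. Since `A_g` is Hurwitz and `A₀` has no stable
eigenvalue, their spectra are disjoint and the Sylvester equation `A_g X + B_g = X A₀` has a
solution `X` (`exists_sylvester_solution`).

On the candidate steady state `ξ = X ω` the errors vanish. The controller rows of the Sylvester
equation read `G₁ Z + G₂ Y = Z A₀` with `Y` the steady virtual error, and the internal model forces
`Y = 0` (`IsInternalModel.eq_zero`). Reachability from the leader and a maximum principle turn zero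
virtual error into zero tracking error. Hence `C_g X = R_g` (`exists_regulator_solution`).

The deviation `ξ - X ω` therefore obeys `η' = A_g η + X (A₀ ω - ω')`, and `e = C_g η`. An
input-to-state estimate for Hurwitz matrices (`IsHurwitz.exists_norm_le`) makes `e` ultimately
bounded when the mismatch is bounded, and convergent to zero when it vanishes. -/

namespace CoopReg

/-! ### Sylvester equations with disjoint spectra -/

section Sylvester

variable {ι κ : Type*} [Fintype ι] [DecidableEq ι] [Fintype κ] [DecidableEq κ]

theorem isCoprime_charpoly {M : Matrix ι ι ℝ} {A₀ : Matrix κ κ ℝ}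
    (hM : IsHurwitz M) (hA₀ : NoStableEigenvalue A₀) : IsCoprime M.charpoly A₀.charpoly := by
  rw [← Polynomial.isCoprime_map (algebraMap ℝ ℂ),
    Polynomial.isCoprime_iff_aeval_ne_zero_of_isAlgClosed ℂ ℂ]
  intro μ
  by_contra! h
  have h1 : μ ∈ spectrum ℂ (M.map (algebraMap ℝ ℂ)) := by
    rw [Matrix.mem_spectrum_iff_isRoot_charpoly, Matrix.charpoly_map]
    simpa using h.1
  have h2 : μ ∈ spectrum ℂ (A₀.map (algebraMap ℝ ℂ)) := by
    rw [Matrix.mem_spectrum_iff_isRoot_charpoly, Matrix.charpoly_map]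
    simpa using h.2
  exact absurd (hM μ h1) (not_lt.mpr (hA₀ μ h2))

theorem aeval_mul_of_intertwines {A : Matrix ι ι ℝ} {B : Matrix κ κ ℝ} {X : Matrix ι κ ℝ}
    (h : A * X = X * B) (r : Polynomial ℝ) :
    Polynomial.aeval A r * X = X * Polynomial.aeval B r := by
  induction r using Polynomial.induction_on' with
  | add r s hr hs => simp [Matrix.add_mul, Matrix.mul_add, hr, hs]
  | monomial k a =>
    have hk : A ^ k * X = X * B ^ k := by
      induction k with
      | zero => simp
      | succ k ih => rw [pow_succ, Matrix.mul_assoc, h, ← Matrix.mul_assoc, ih, Matrix.mul_assoc,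
          ← pow_succ]
    simp [Polynomial.aeval_monomial, Algebra.algebraMap_eq_smul_one, hk]

/-- The Sylvester equation is solvable when the coefficient matrices have no common eigenvalue. -/
theorem exists_sylvester_solution {A : Matrix ι ι ℝ} {B : Matrix κ κ ℝ}
    (h : IsCoprime A.charpoly B.charpoly) (Q : Matrix ι κ ℝ) :
    ∃ X : Matrix ι κ ℝ, A * X - X * B = Q := by
  let L : Matrix ι κ ℝ →ₗ[ℝ] Matrix ι κ ℝ :=
    { toFun := fun X => A * X - X * B
      map_add' := fun X Y => by simp [Matrix.mul_add, Matrix.add_mul]; abel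
      map_smul' := fun a X => by simp [smul_sub] }
  have hinj : Function.Injective L := by
    rw [injective_iff_map_eq_zero]
    intro X hX
    have hX' : A * X = X * B := sub_eq_zero.mp hX
    -- By Cayley–Hamilton, `u * A.charpoly` is `0` at `A` and, by Bézout, `1` at `B`; intertwining
    -- then gives `X = 0`.
    obtain ⟨u, v, huv⟩ := h
    have h1 : Polynomial.aeval B (u * A.charpoly) = 1 := by
      have := congrArg (Polynomial.aeval B) huv
      simpa [Matrix.aeval_self_charpoly] using this
    calc X = X * Polynomial.aeval B (u * A.charpoly) := by rw [h1, Matrix.mul_one]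
      _ = Polynomial.aeval A (u * A.charpoly) * X := (aeval_mul_of_intertwines hX' _).symm
      _ = 0 := by simp [Matrix.aeval_self_charpoly]
  exact (LinearMap.injective_iff_surjective.mp hinj) Q

end Sylvester

/-! ### Internal model principle -/

section InternalModel

open Polynomial in
-- Controllability supplies a row `φ` with `φ β^k σ = 0` for `k < s - 1` and `φ β^(s-1) σ = 1`.
-- Multiplying the equation by `φ β^k` gives `φ β^k Z = φ Z A₀^k` up to `k = s - 1`, while at `k =
-- s` the extra term `-y` appears. The monic polynomial of degree `s` that annihilates both `β` and
-- `A₀` isolates this term.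
theorem row_eq_zero_of_isControllablePair {s q : ℕ} {A₀ : Matrix (Fin q) (Fin q) ℝ}
    {β : Matrix (Fin s) (Fin s) ℝ} {σ : Fin s → ℝ} (hc : IsControllablePair β σ)
    (hm : minpoly ℝ A₀ = β.charpoly) {Z : Matrix (Fin s) (Fin q) ℝ} {y : Fin q → ℝ}
    (h : β * Z + Matrix.vecMulVec σ y = Z * A₀) : y = 0 := by
  have hdeg : (minpoly ℝ A₀).natDegree = s := by
    rw [hm, Matrix.charpoly_natDegree_eq_dim, Fintype.card_fin]
  have hmonic : (minpoly ℝ A₀).Monic := minpoly.monic (Matrix.isIntegral A₀)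
  rcases Nat.eq_zero_or_pos s with hs | hs
  -- For `s = 0` the minimal polynomial is `1`, so `1 = 0` among the `q × q` matrices and every row
  -- vanishes.
  · have h1 : minpoly ℝ A₀ = 1 := hmonic.natDegree_eq_zero.mp (hdeg.trans hs)
    have h2 : (1 : Matrix (Fin q) (Fin q) ℝ) = 0 := by
      have := minpoly.aeval ℝ A₀
      rwa [h1, map_one] at this
    rw [← Matrix.vecMul_one y, h2, Matrix.vecMul_zero]
  obtain ⟨t, rfl⟩ : ∃ t, s = t + 1 := ⟨s - 1, by omega⟩
  set K : Matrix (Fin (t + 1)) (Fin (t + 1)) ℝ :=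
    Matrix.of fun r c => ((β ^ (c : ℕ)) *ᵥ σ) r with hK
  have hKrank : K.rank = t + 1 := hc
  have hsurj : ∃ φ : Fin (t + 1) → ℝ, φ ᵥ* K = Pi.single (Fin.last t) 1 := by
    have hr : LinearMap.range Kᵀ.mulVecLin = ⊤ := by
      apply Submodule.eq_top_of_finrank_eq
      rw [← Matrix.rank, Matrix.rank_transpose, hKrank]
      simp
    obtain ⟨φ, hφ⟩ := LinearMap.range_eq_top.mp hr (Pi.single (Fin.last t) 1)
    exact ⟨φ, by simpa [Matrix.mulVec_transpose] using hφ⟩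
  obtain ⟨φ, hφ⟩ := hsurj
  have hφσ : ∀ k (hk : k < t + 1), φ ⬝ᵥ (β ^ k *ᵥ σ) = if k = t then 1 else 0 := by
    intro k hk
    have := congrFun hφ ⟨k, hk⟩
    simp only [Pi.single_apply, Fin.ext_iff, Fin.val_last] at this
    exact this
  have hstep : ∀ k, φ ᵥ* β ^ (k + 1) ᵥ* Z = (φ ᵥ* β ^ k ᵥ* Z) ᵥ* A₀ -
      (φ ⬝ᵥ (β ^ k *ᵥ σ)) • y := by
    intro k
    have h' : Z * A₀ - Matrix.vecMulVec σ y = β * Z := by rw [← h, add_sub_cancel_right]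
    rw [pow_succ, Matrix.vecMul_vecMul, Matrix.mul_assoc, ← h', Matrix.mul_sub,
      Matrix.vecMul_sub, Matrix.mul_vecMulVec, Matrix.vecMul_vecMulVec, Matrix.vecMul_vecMul,
      Matrix.vecMul_vecMul]
  have hlow : ∀ k, k ≤ t → φ ᵥ* β ^ k ᵥ* Z = (φ ᵥ* Z) ᵥ* A₀ ^ k := by
    intro k
    induction k with
    | zero => simp
    | succ k ih =>
      intro hk
      rw [hstep, ih (by omega), hφσ k (by omega), if_neg (by omega), zero_smul, sub_zero,
        Matrix.vecMul_vecMul, pow_succ]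
  have htop : φ ᵥ* β ^ (t + 1) ᵥ* Z = (φ ᵥ* Z) ᵥ* A₀ ^ (t + 1) - y := by
    rw [hstep, hlow t le_rfl, hφσ t (by omega), if_pos rfl, one_smul, Matrix.vecMul_vecMul,
      pow_succ]
  have e1 : φ ᵥ* (aeval β (minpoly ℝ A₀)) ᵥ* Z = 0 := by
    rw [hm, Matrix.aeval_self_charpoly]; simp
  have e2 : (φ ᵥ* Z) ᵥ* (aeval A₀ (minpoly ℝ A₀)) = 0 := by
    rw [minpoly.aeval]; simp
  have hlead : (minpoly ℝ A₀).coeff (t + 1) = 1 := by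
    rw [← hdeg]; exact hmonic.coeff_natDegree
  have hv : ∀ {a b : ℕ} (v : Fin a → ℝ) (f : ℕ → Matrix (Fin a) (Fin b) ℝ) (S : Finset ℕ),
      v ᵥ* (∑ k ∈ S, f k) = ∑ k ∈ S, v ᵥ* f k := by
    intro a b v f S
    exact map_sum (Matrix.vecMulBilin ℝ ℝ v) f S
  rw [aeval_eq_sum_range, hdeg, Finset.sum_range_succ, hlead, one_smul, Matrix.vecMul_vecMul,
    Matrix.add_mul, Matrix.sum_mul, Matrix.vecMul_add, hv, ← Matrix.vecMul_vecMul, htop] at e1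
  rw [aeval_eq_sum_range, hdeg, Finset.sum_range_succ, hlead, one_smul, Matrix.vecMul_add, hv]
    at e2
  have e3 : ∀ k ∈ Finset.range (t + 1),
      φ ᵥ* ((minpoly ℝ A₀).coeff k • β ^ k * Z) =
        (φ ᵥ* Z) ᵥ* ((minpoly ℝ A₀).coeff k • A₀ ^ k) := by
    intro k hk
    rw [Finset.mem_range] at hk
    rw [Matrix.smul_mul, Matrix.vecMul_smul, Matrix.vecMul_smul, ← Matrix.vecMul_vecMul,
      hlow k (by omega)]
  rw [Finset.sum_congr rfl e3, ← add_sub_assoc, e2, zero_sub, neg_eq_zero] at e1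
  exact e1

theorem IsInternalModel.eq_zero {p q r : ℕ} {A₀ : Matrix (Fin q) (Fin q) ℝ}
    {G₁ : Matrix (Fin r) (Fin r) ℝ} {G₂ : Matrix (Fin r) (Fin p) ℝ}
    (hG : IsInternalModel A₀ G₁ G₂) {Z : Matrix (Fin r) (Fin q) ℝ} {Y : Matrix (Fin p) (Fin q) ℝ}
    (h : G₁ * Z + G₂ * Y = Z * A₀) : Y = 0 := by
  obtain ⟨s, hs, β, σ, hβ, rfl, rfl⟩ := hG
  set e := (finSigmaFinEquiv (n := s)).trans (finCongr hs)
  ext l j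
  have key : β l * (Matrix.of fun a j => Z (e ⟨l, a⟩) j) + Matrix.vecMulVec (σ l) (Y l) =
      (Matrix.of fun a j => Z (e ⟨l, a⟩) j) * A₀ := by
    ext a j
    have := congrFun (congrFun h (e ⟨l, a⟩)) j
    simp only [Matrix.add_apply, Matrix.mul_apply, Matrix.reindex_apply, Matrix.submatrix_apply,
      Equiv.symm_apply_apply, Matrix.of_apply, Equiv.refl_symm, Equiv.refl_apply] at this ⊢
    rw [← this, ← e.sum_comp, Fintype.sum_sigma]
    simp only [Equiv.symm_apply_apply]
    rw [Finset.sum_eq_single l]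
    · simp [Matrix.vecMulVec_apply]
    · intro b _ hb
      exact Finset.sum_eq_zero fun x _ => by rw [Matrix.blockDiagonal'_apply_ne _ _ _ hb.symm,
        zero_mul]
    · simp
  exact congrFun (row_eq_zero_of_isControllablePair (hβ l).1 (hβ l).2 key) j

end InternalModel

/-! ### Graph and discrete maximum principle -/

namespace AugmentedDigraph

variable {N : ℕ} (g : AugmentedDigraph N)

theorem a_eq_ite_mem_nbrs (i j : Fin N) : g.a i j = if j ∈ g.nbrs i then g.a i j else 0 := by
  by_cases h : 0 < g.a i j
  · simp [nbrs, h]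
  · simp [nbrs, le_antisymm (not_lt.mp h) (g.a_nonneg i j)]

theorem sum_nbrs {M : Type*} [AddCommGroup M] [Module ℝ M] (i : Fin N) (f : Fin N → M) :
    ∑ j ∈ g.nbrs i, g.a i j • f j = ∑ j, g.a i j • f j := by
  refine Finset.sum_subset (Finset.subset_univ _) fun j _ hj => ?_
  rw [a_eq_ite_mem_nbrs, if_neg hj, zero_smul]

theorem d_eq (i : Fin N) : g.d i = ∑ j, g.a i j := by
  simpa [d] using g.sum_nbrs i (fun _ => (1 : ℝ))

variable {g}

/-- The last edge of a path from the leader ends at `i` and has positive weight. This makes the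
division in the virtual error legitimate. -/
theorem HasSpanningTreeFromLeader.d_add_k_pos (hg : g.HasSpanningTreeFromLeader) (i : Fin N) :
    0 < g.d i + g.k i := by
  have hd : 0 ≤ g.d i := Finset.sum_nonneg fun j _ => g.a_nonneg i j
  obtain ⟨b, -, hb⟩ := Relation.TransGen.tail'_iff.mp (hg (some i) (by simp))
  cases b with
  | none => exact add_pos_of_nonneg_of_pos hd hb
  | some j =>
    have hj : 0 < g.a i j := hb
    refine add_pos_of_pos_of_nonneg ?_ (g.k_nonneg i)
    rw [d_eq]
    exact Finset.sum_pos' (fun j _ => g.a_nonneg i j) ⟨j, Finset.mem_univ _, hj⟩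

/-- If all followers can be reached from the leader, a function on the followers that satisfies the
discrete maximum principle with leader value zero vanishes. -/
theorem HasSpanningTreeFromLeader.eq_zero (hg : g.HasSpanningTreeFromLeader) {v : Fin N → ℝ}
    (hv : ∀ i, (g.d i + g.k i) * v i = ∑ j, g.a i j * v j) : v = 0 := by
  by_contra hne
  obtain ⟨i₁, hi₁⟩ := Function.ne_iff.mp hne
  obtain ⟨i₀, -, hmax⟩ := Finset.exists_max_image Finset.univ (fun i => |v i|)
    ⟨i₁, Finset.mem_univ _⟩
  have hpos : 0 < |v i₀| := lt_of_lt_of_le (abs_pos.mpr hi₁) (hmax i₁ (Finset.mem_univ _))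
  -- Where `|v|` is maximal, the averaging identity is tight: the leader weight is zero and all
  -- in-neighbours are maximal too.
  have step : ∀ i, |v i| = |v i₀| → g.k i = 0 ∧ ∀ j, 0 < g.a i j → |v j| = |v i₀| := by
    intro i hi
    have h1 : (g.d i + g.k i) * |v i₀| ≤ ∑ j, g.a i j * |v j| := by
      rw [← hi, ← abs_of_pos (hg.d_add_k_pos i), ← abs_mul, hv]
      refine (Finset.abs_sum_le_sum_abs _ _).trans_eq (Finset.sum_congr rfl fun j _ => ?_)
      rw [abs_mul, abs_of_nonneg (g.a_nonneg i j)]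
    have h2 : ∀ j, 0 ≤ g.a i j * (|v i₀| - |v j|) := fun j =>
      mul_nonneg (g.a_nonneg i j) (sub_nonneg.mpr (hmax j (Finset.mem_univ _)))
    have h3 : g.k i * |v i₀| + ∑ j, g.a i j * (|v i₀| - |v j|) ≤ 0 := by
      simp only [mul_sub, Finset.sum_sub_distrib, ← Finset.sum_mul, ← d_eq]
      linarith
    have h4 : 0 ≤ g.k i * |v i₀| := mul_nonneg (g.k_nonneg i) hpos.le
    have h5 : 0 ≤ ∑ j, g.a i j * (|v i₀| - |v j|) := Finset.sum_nonneg fun j _ => h2 j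
    refine ⟨?_, fun j hj => ?_⟩
    · have : g.k i * |v i₀| = 0 := by linarith
      exact (mul_eq_zero.mp this).resolve_right hpos.ne'
    · have h6 := (Finset.sum_eq_zero_iff_of_nonneg fun j _ => h2 j).mp (by linarith) j
        (Finset.mem_univ _)
      have := (mul_eq_zero.mp h6).resolve_left hj.ne'
      linarith
  -- Maximality would propagate backwards along a path to a follower that observes the leader, where
  -- `k > 0`.
  have back : ∀ w, Relation.TransGen g.toDigraph.Adj none w → ∀ i, w = some i →
      |v i| ≠ |v i₀| := by
    intro w hw
    induction hw with
    | single h =>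
      rintro i rfl hi
      have h' : 0 < g.k i := h
      exact h'.ne' (step i hi).1
    | @tail b w _ h ih =>
      rintro i rfl hi
      cases b with
      | none =>
        have h' : 0 < g.k i := h
        exact h'.ne' (step i hi).1
      | some j => exact ih j rfl ((step i hi).2 j h)
  exact back _ (hg (some i₀) (by simp)) i₀ rfl rfl

end AugmentedDigraph

/-! ### Exponential decay from the spectrum -/

section ExponentialDecay

open scoped NNReal ENNReal

variable {𝔸 : Type*} [NormedRing 𝔸] [NormedAlgebra ℂ 𝔸] [CompleteSpace 𝔸]

/-- Gelfand's formula gives `‖b ^ n‖ ≤ r ^ n` for large `n`; the constant `M` absorbs the finitely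
many other powers. -/
theorem exists_norm_pow_le {b : 𝔸} {r : ℝ≥0} (hr : spectralRadius ℂ b < r) :
    ∃ M : ℝ, 0 ≤ M ∧ ∀ n, ‖b ^ n‖ ≤ M * (r : ℝ) ^ n := by
  have hr0 : (0 : ℝ) < r := by
    have : (0 : ℝ≥0∞) < r := lt_of_le_of_lt zero_le hr
    exact_mod_cast this
  have h1 := (spectrum.pow_nnnorm_pow_one_div_tendsto_nhds_spectralRadius b).eventually_lt_const hr
  obtain ⟨n₀, hn₀⟩ := eventually_atTop.mp h1
  have h2 : ∀ n, n₀ + 1 ≤ n → ‖b ^ n‖ ≤ (r : ℝ) ^ n := by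
    intro n hn
    have h3 := (hn₀ n (by omega)).le
    have hn0 : (0 : ℝ) < n := by exact_mod_cast (by omega : 0 < n)
    rw [one_div, ENNReal.rpow_inv_le_iff hn0, ENNReal.rpow_natCast] at h3
    exact_mod_cast h3
  refine ⟨1 + ∑ n ∈ Finset.range (n₀ + 1), ‖b ^ n‖ / (r : ℝ) ^ n, by positivity, fun n => ?_⟩
  rcases lt_or_ge n (n₀ + 1) with hn | hn
  · rw [← div_le_iff₀ (by positivity)]
    have := Finset.single_le_sum (f := fun n => ‖b ^ n‖ / (r : ℝ) ^ n)
      (fun i _ => by positivity) (Finset.mem_range.mpr hn)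
    linarith
  · refine (h2 n hn).trans (le_mul_of_one_le_left (by positivity) ?_)
    exact le_add_of_nonneg_right (Finset.sum_nonneg fun i _ => by positivity)

omit [CompleteSpace 𝔸] in
theorem norm_exp_smul_le {b : 𝔸} {M r : ℝ} (hb : ∀ n, ‖b ^ n‖ ≤ M * r ^ n) {τ : ℝ}
    (hτ : 0 ≤ τ) : ‖NormedSpace.exp ((τ : ℂ) • b)‖ ≤ M * Real.exp (τ * r) := by
  have hs : HasSum (fun n : ℕ => M * ((τ * r) ^ n / n.factorial)) (M * Real.exp (τ * r)) := by
    rw [Real.exp_eq_exp_ℝ]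
    exact (NormedSpace.expSeries_div_hasSum_exp (τ * r)).mul_left M
  rw [NormedSpace.exp_eq_tsum ℂ]
  refine tsum_of_norm_bounded hs fun n => ?_
  rw [smul_pow, smul_smul, norm_smul, norm_mul, norm_inv, norm_pow, Complex.norm_real,
    Complex.norm_natCast, Real.norm_of_nonneg hτ, mul_pow]
  calc ((n.factorial : ℝ)⁻¹ * τ ^ n) * ‖b ^ n‖ ≤ ((n.factorial : ℝ)⁻¹ * τ ^ n) * (M * r ^ n) := by
        gcongr; exact hb n
    _ = _ := by ring

/-- If the spectrum of `a` lies in the open left half plane, `exp (t a)` decays exponentially. -/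
theorem exists_norm_exp_le {a : 𝔸} (ha : ∀ μ ∈ spectrum ℂ a, μ.re < 0) :
    ∃ M ℓ : ℝ, 0 ≤ M ∧ 0 < ℓ ∧
      ∀ t : ℝ, 0 ≤ t → ‖NormedSpace.exp ((t : ℂ) • a)‖ ≤ M * Real.exp (-ℓ * t) := by
  rcases subsingleton_or_nontrivial 𝔸 with h𝔸 | h𝔸
  · refine ⟨0, 1, le_rfl, one_pos, fun t _ => ?_⟩
    rw [Subsingleton.elim (NormedSpace.exp ((t : ℂ) • a)) 0]
    simp
  obtain ⟨μ₀, hμ₀, hmax⟩ := (spectrum.isCompact (𝕜 := ℂ) a).exists_isMaxOn (spectrum.nonempty a)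
    Complex.continuous_re.continuousOn
  set δ := -μ₀.re with hδ
  have hδ0 : 0 < δ := by linarith [ha μ₀ hμ₀]
  -- An Euler step `b = 1 + h a` small enough that `h |μ|² ≤ δ` on the spectrum, whence `|1 + h μ|²
  -- ≤ 1 - h δ < 1`. The factors `‖1‖` appear because the unit need not have norm one.
  set h : ℝ := δ / (‖a‖ ^ 2 * ‖(1 : 𝔸)‖ ^ 2 + 1) with hh
  have hh0 : 0 < h := by positivity
  have hha : h * (‖a‖ ^ 2 * ‖(1 : 𝔸)‖ ^ 2 + 1) = δ := by
    rw [hh]; field_simp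
  set b : 𝔸 := 1 + (h : ℂ) • a with hb
  have hspec : ∀ z ∈ spectrum ℂ b, ‖z‖₊ < 1 := by
    intro z hz
    have hbp : b = Polynomial.aeval a (1 + Polynomial.C (h : ℂ) * Polynomial.X) := by
      simp [hb, Algebra.smul_def]
    rw [hbp, spectrum.map_polynomial_aeval] at hz
    obtain ⟨μ, hμ, rfl⟩ := hz
    have h1 : μ.re ≤ -δ := by rw [hδ, neg_neg]; exact hmax hμ
    have h2 : ‖μ‖ ≤ ‖a‖ * ‖(1 : 𝔸)‖ := spectrum.norm_le_norm_mul_of_mem hμ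
    have h3 : ‖μ‖ ^ 2 = μ.re ^ 2 + μ.im ^ 2 := by
      rw [Complex.sq_norm, Complex.normSq_apply]; ring
    have h4 : ‖μ‖ ^ 2 ≤ ‖a‖ ^ 2 * ‖(1 : 𝔸)‖ ^ 2 := by
      rw [← mul_pow]; gcongr
    have h5 : ‖1 + (h : ℂ) * μ‖ ^ 2 < 1 := by
      have : ‖1 + (h : ℂ) * μ‖ ^ 2 = 1 + h * (2 * μ.re + h * ‖μ‖ ^ 2) := by
        rw [h3, Complex.sq_norm, Complex.normSq_apply]
        simp
        ring
      rw [this]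
      have h6 : h * ‖μ‖ ^ 2 ≤ δ := by rw [← hha]; gcongr; linarith
      have h7 : 0 < h * (-(2 * μ.re + h * ‖μ‖ ^ 2)) := mul_pos hh0 (by linarith)
      linarith
    have h8 : ‖1 + (h : ℂ) * μ‖ < 1 := by
      by_contra! hc
      nlinarith
    have : ‖Polynomial.eval μ (1 + Polynomial.C (h : ℂ) * Polynomial.X)‖ < 1 := by
      simpa using h8
    exact_mod_cast this
  have hrad : spectralRadius ℂ b < (1 : ℝ≥0) := spectrum.spectralRadius_lt_of_forall_lt b hspec
  obtain ⟨r, hr, hr1⟩ := ENNReal.lt_iff_exists_nnreal_btwn.mp hrad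
  have hr1' : (r : ℝ) < 1 := by exact_mod_cast hr1
  obtain ⟨M, hM, hMb⟩ := exists_norm_pow_le hr
  refine ⟨‖(1 : 𝔸)‖ * M, (1 - r) / h, by positivity, div_pos (by linarith) hh0, fun t ht => ?_⟩
  -- Thus `exp (t a) = e^(-t/h) exp ((t/h) b)`, and `‖b ^ n‖ ≤ M r ^ n` with `r < 1` gives the decay
  -- rate `(1 - r) / h`.
  have hsplit : (t : ℂ) • a = algebraMap ℂ 𝔸 (-(t / h) : ℝ) + ((t / h : ℝ) : ℂ) • b := by
    rw [hb, smul_add, smul_smul, Algebra.algebraMap_eq_smul_one, ← add_assoc, ← add_smul]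
    have h1 : ((-(t / h) : ℝ) : ℂ) + ((t / h : ℝ) : ℂ) = 0 := by push_cast; ring
    have h2 : ((t / h : ℝ) : ℂ) * (h : ℂ) = t := by
      rw [← Complex.ofReal_mul, div_mul_cancel₀ _ hh0.ne']
    rw [h1, h2, zero_smul, zero_add]
  let _ : NormedAlgebra ℚ 𝔸 := NormedAlgebra.restrictScalars ℚ ℂ 𝔸
  rw [hsplit, NormedSpace.exp_add_of_commute (Algebra.commutes _ _),
    ← NormedSpace.algebraMap_exp_comm]
  refine (norm_mul_le _ _).trans ?_
  have e1 : ‖algebraMap ℂ 𝔸 (NormedSpace.exp ((-(t / h) : ℝ) : ℂ))‖ =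
      Real.exp (-(t / h)) * ‖(1 : 𝔸)‖ := by
    rw [norm_algebraMap, ← Complex.exp_eq_exp_ℂ, Complex.norm_exp, Complex.ofReal_re]
  have e2 := norm_exp_smul_le hMb (div_nonneg ht hh0.le)
  rw [e1]
  calc Real.exp (-(t / h)) * ‖(1 : 𝔸)‖ * ‖NormedSpace.exp (((t / h : ℝ) : ℂ) • b)‖
      ≤ Real.exp (-(t / h)) * ‖(1 : 𝔸)‖ * (M * Real.exp (t / h * r)) := by gcongr
    _ = ‖(1 : 𝔸)‖ * M * (Real.exp (-(t / h)) * Real.exp (t / h * r)) := by ring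
    _ = _ := by rw [← Real.exp_add]; congr 2; ring

end ExponentialDecay

/-! ### Input-to-state estimates -/

section PerturbedLinear

variable {E : Type*} [NormedAddCommGroup E] [NormedSpace ℂ E] [CompleteSpace E]

/-- Variation of constants without integrals: `exp ((T - s) a) ξ(s)` has right derivative `exp ((T -
s) a) δ(s)`, whose norm is compared with the derivative of an explicit bound. Right derivatives
suffice, so corners of the exosystem trajectory do no harm. -/
theorem norm_le_of_hasDerivWithinAt_perturbed {a : E →L[ℂ] E} {M ℓ : ℝ} (hℓ : 0 < ℓ)
    (hM : 0 ≤ M)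
    (hexp : ∀ t : ℝ, 0 ≤ t → ‖NormedSpace.exp ((t : ℂ) • a)‖ ≤ M * Real.exp (-ℓ * t))
    {ξ δ : ℝ → E} {S ε : ℝ} (hξc : ContinuousOn ξ (Ici S))
    (hξ : ∀ t, S ≤ t → HasDerivWithinAt ξ (a (ξ t) + δ t) (Ici t) t)
    (hδ : ∀ t, S ≤ t → ‖δ t‖ ≤ ε) {T : ℝ} (hT : S ≤ T) :
    ‖ξ T‖ ≤ M * Real.exp (-ℓ * (T - S)) * ‖ξ S‖ + M / ℓ * ε := by
  have hε : 0 ≤ ε := (norm_nonneg _).trans (hδ S le_rfl)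
  set U : ℝ → E →L[ℂ] E := fun s => NormedSpace.exp (((T - s : ℝ) : ℂ) • a) with hU
  have hUd : ∀ s, HasDerivAt U (-(U s * a)) s := by
    intro s
    have h1 : HasDerivAt (fun t : ℝ => NormedSpace.exp ((t : ℂ) • a)) (U s * a) (T - s) := by
      refine (HasDerivAt.scomp (T - s) (hasDerivAt_exp_smul_const (𝕂 := ℂ) a ((T - s : ℝ) : ℂ))
        Complex.ofRealCLM.hasDerivAt).congr_deriv ?_
      simp [hU]
    have h2 : HasDerivAt (fun s : ℝ => T - s) (-1) s := by
      simpa using (hasDerivAt_id s).const_sub T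
    refine (h1.scomp s h2).congr_deriv ?_
    simp
  let R := ContinuousLinearMap.restrictScalarsL ℂ E E ℝ ℝ
  have hφ : ∀ s, S ≤ s →
      HasDerivWithinAt (fun s => U s (ξ s)) (U s (δ s)) (Ici s) s := by
    intro s hs
    have h1 : HasDerivWithinAt (fun s => R (U s)) (R (-(U s * a))) (Ici s) s :=
      (R.hasFDerivAt.comp_hasDerivAt s (hUd s)).hasDerivWithinAt
    have h2 := h1.clm_apply (hξ s hs)
    refine h2.congr_deriv ?_
    simp [R]
  have hφc : ContinuousOn (fun s => U s (ξ s)) (Icc S T) := by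
    have h1 : Continuous U := continuous_iff_continuousAt.mpr fun s => (hUd s).continuousAt
    exact h1.continuousOn.clm_apply (hξc.mono Icc_subset_Ici_self)
  let B : ℝ → ℝ := fun s => M * Real.exp (-ℓ * (T - S)) * ‖ξ S‖ +
    M / ℓ * ε * (Real.exp (-ℓ * (T - s)) - Real.exp (-ℓ * (T - S)))
  have hBd : ∀ s, HasDerivAt B (M * Real.exp (-ℓ * (T - s)) * ε) s := by
    intro s
    have h1 : HasDerivAt (fun s => -ℓ * (T - s)) ℓ s := by
      simpa using ((hasDerivAt_id s).const_sub T).const_mul (-ℓ)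
    have h2 := ((h1.exp.sub_const (Real.exp (-ℓ * (T - S)))).const_mul (M / ℓ * ε)).const_add
      (M * Real.exp (-ℓ * (T - S)) * ‖ξ S‖)
    refine h2.congr_deriv ?_
    field_simp
  have key := image_norm_le_of_norm_deriv_right_le_deriv_boundary hφc
    (fun s hs => hφ s hs.1) (B := B) ?_ hBd ?_ (right_mem_Icc.mpr hT)
  · have h1 : U T = 1 := by simp [hU]
    rw [h1] at key
    refine key.trans ?_
    simp only [B, sub_self, mul_zero, Real.exp_zero]
    refine add_le_add_right (mul_le_of_le_one_right (by positivity) ?_) _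
    linarith [Real.exp_pos (-ℓ * (T - S))]
  · simp only [B]
    rw [sub_self, mul_zero, add_zero]
    exact ((U S).le_opNorm _).trans (by gcongr; exact hexp _ (by linarith))
  · intro s hs
    exact ((U s).le_opNorm _).trans (mul_le_mul (hexp _ (by linarith [hs.2])) (hδ s hs.1)
      (norm_nonneg _) (by positivity))

/-- Input-to-state estimate for a Hurwitz matrix. -/
theorem IsHurwitz.exists_norm_le {ι : Type*} [Fintype ι] [DecidableEq ι] {A : Matrix ι ι ℝ}
    (hA : IsHurwitz A) : ∃ M ℓ : ℝ, 0 ≤ M ∧ 0 < ℓ ∧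
      ∀ (ξ δ : ℝ → ι → ℝ) (S ε : ℝ), ContinuousOn ξ (Ici S) →
        (∀ t, S ≤ t → HasDerivWithinAt ξ (A *ᵥ ξ t + δ t) (Ici t) t) →
        (∀ t, S ≤ t → ‖δ t‖ ≤ ε) → ∀ T, S ≤ T →
        ‖ξ T‖ ≤ M * Real.exp (-ℓ * (T - S)) * ‖ξ S‖ + M * ε := by
  set Ac := A.map (algebraMap ℝ ℂ) with hAc
  set a : (ι → ℂ) →L[ℂ] (ι → ℂ) :=
    Module.End.toContinuousLinearMap (ι → ℂ) (Matrix.toLin' Ac) with ha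
  have haspec : ∀ μ ∈ spectrum ℂ a, μ.re < 0 := by
    rw [ha, AlgEquiv.spectrum_eq, Matrix.spectrum_toLin']
    exact hA
  obtain ⟨M, ℓ, hM, hℓ, hexp⟩ := exists_norm_exp_le haspec
  have hMℓ : 0 ≤ M / ℓ := by positivity
  refine ⟨M + M / ℓ, ℓ, by positivity, hℓ, fun ξ δ S ε hc hd hδ T hT => ?_⟩
  have hε : 0 ≤ ε := (norm_nonneg _).trans (hδ S le_rfl)
  -- Complexification preserves the sup norm, so the complex estimate transfers back to the real
  -- system.
  let J : (ι → ℝ) →L[ℝ] (ι → ℂ) :=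
    ContinuousLinearMap.pi fun i => Complex.ofRealCLM.comp (ContinuousLinearMap.proj i)
  have hJ : ∀ v, ‖J v‖ = ‖v‖ := by
    intro v
    simp [J, Pi.norm_def, Complex.nnnorm_real]
  have hJa : ∀ v, J (A *ᵥ v) = a (J v) := by
    intro v
    ext i
    simp [J, ha, hAc, Module.End.toContinuousLinearMap, Matrix.mulVec, dotProduct]
  have := norm_le_of_hasDerivWithinAt_perturbed hℓ hM hexp (ξ := fun t => J (ξ t))
    (δ := fun t => J (δ t)) (S := S) (ε := ε) (J.continuous.comp_continuousOn hc)
    (fun t ht => by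
      rw [← hJa, ← map_add]
      exact J.hasFDerivAt.comp_hasDerivWithinAt t (hd t ht))
    (fun t ht => by rw [hJ]; exact hδ t ht) hT
  rw [hJ, hJ] at this
  refine this.trans (add_le_add ?_ ?_)
  · gcongr; linarith
  · gcongr; linarith

end PerturbedLinear

/-! ### Right derivatives of the exosystem trajectory -/

section RightDerivative

variable {q : ℕ} {ω dω : ℝ → Fin q → ℝ}

/-- At an exceptional instant the value of `dω` carries no information. Just to the right of it `ω`
is differentiable with derivative `dω`, so the right limit of `dω` is the right derivative of `ω`.
-/
theorem HasPiecewiseContinuousDeriv.exists_rightDeriv (h : HasPiecewiseContinuousDeriv ω dω) :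
    ∃ ω' : ℝ → Fin q → ℝ, ∀ t, 0 ≤ t →
      HasDerivWithinAt ω (ω' t) (Ici t) t ∧ Tendsto dω (𝓝[>] t) (𝓝 (ω' t)) := by
  obtain ⟨J, hJ, hd⟩ := h.hasDeriv
  have key : ∀ t, ∃ l, 0 ≤ t →
      HasDerivWithinAt ω l (Ici t) t ∧ Tendsto dω (𝓝[>] t) (𝓝 l) := by
    intro t
    by_cases ht : 0 ≤ t
    swap
    · exact ⟨0, fun h => absurd h ht⟩
    obtain ⟨l, hl⟩ := h.piecewise.2.1 t ht
    refine ⟨l, fun _ => ⟨?_, hl⟩⟩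
    have hder : ∀ x ∈ Ioi t \ J, HasDerivAt ω (dω x) x := fun x hx =>
      (hd x (ht.trans hx.1.le) hx.2).hasDerivAt (Ici_mem_nhds (ht.trans_lt hx.1))
    have hmem : Ioi t \ J ∈ 𝓝[>] t := by
      -- The point `t` is removed because it may itself be exceptional.
      have h1 : ((J ∩ Icc 0 (t + 1)) \ {t})ᶜ ∈ 𝓝 t :=
        ((hJ (t + 1)).subset sdiff_subset).isClosed.isOpen_compl.mem_nhds (by simp)
      have h2 : Iio (t + 1) ∈ 𝓝 t := Iio_mem_nhds (by linarith)
      filter_upwards [self_mem_nhdsWithin, mem_nhdsWithin_of_mem_nhds h1,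
        mem_nhdsWithin_of_mem_nhds h2] with x hx hx1 hx2
      exact ⟨hx, fun hxJ => hx1 ⟨⟨hxJ, ht.trans (le_of_lt hx), le_of_lt hx2⟩, ne_of_gt hx⟩⟩
    refine hasDerivWithinAt_Ici_of_tendsto_deriv
      (fun x hx => (hder x hx).differentiableAt.differentiableWithinAt)
      ((h.continuousOn t ht).mono fun x hx => ht.trans (le_of_lt hx.1)) hmem
      (hl.congr' ?_)
    filter_upwards [hmem] with x hx using (hder x hx).deriv.symm
  choose ω' hω' using key
  exact ⟨ω', hω'⟩

theorem norm_mismatch_le_of_tendsto {A₀ : Matrix (Fin q) (Fin q) ℝ}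
    (hc : ContinuousOn ω (Ici 0)) {l : Fin q → ℝ} {S t ε : ℝ} (hS : 0 ≤ S) (ht : S ≤ t)
    (hl : Tendsto dω (𝓝[>] t) (𝓝 l)) (hε : ∀ s, S ≤ s → ‖A₀ *ᵥ ω s - dω s‖ ≤ ε) :
    ‖A₀ *ᵥ ω t - l‖ ≤ ε := by
  have h1 : Tendsto ω (𝓝[>] t) (𝓝 (ω t)) :=
    (hc t (hS.trans ht)).mono_left (nhdsWithin_mono _ fun x hx => (hS.trans ht).trans (le_of_lt hx))
  have h2 : Continuous fun v : Fin q → ℝ => A₀ *ᵥ v := continuous_const.matrix_mulVec continuous_id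
  refine le_of_tendsto (((h2.tendsto _).comp h1).sub hl).norm ?_
  filter_upwards [self_mem_nhdsWithin] with x hx using hε x (ht.trans (le_of_lt hx))

end RightDerivative

/-! ### Stacked closed loop and regulator equations -/

section Stack

variable {N p q : ℕ}

/-- The concatenation of a family of vectors. -/
def stack {n : Fin N → ℕ} (x : ∀ i, Fin (n i) → ℝ) : (Σ i, Fin (n i)) → ℝ := fun s => x s.1 s.2

theorem blockDiagonal'_mulVec_stack {n m : Fin N → ℕ}
    (M : ∀ i, Matrix (Fin (m i)) (Fin (n i)) ℝ) (x : ∀ i, Fin (n i) → ℝ) :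
    Matrix.blockDiagonal' M *ᵥ stack x = stack fun i => M i *ᵥ x i := by
  ext ⟨i, a⟩
  simp only [Matrix.mulVec, dotProduct, stack, Fintype.sum_sigma]
  rw [Finset.sum_eq_single i]
  · simp
  · intro b _ hb
    exact Finset.sum_eq_zero fun x _ => by
      rw [Matrix.blockDiagonal'_apply_ne _ _ _ hb.symm, zero_mul]
  · simp

theorem stack_add {n : Fin N → ℕ} (x y : ∀ i, Fin (n i) → ℝ) :
    stack x + stack y = stack (x + y) := rfl

theorem AugmentedDigraph.W_mulVec_stack (g : AugmentedDigraph N) (e : Fin N → Fin p → ℝ) :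
    g.W p *ᵥ (stack e) =
      stack fun i => e i - (1 / (g.d i + g.k i)) • ∑ j, g.a i j • e j := by
  ext ⟨i, l⟩
  simp only [Matrix.mulVec, dotProduct, stack, AugmentedDigraph.W, Fintype.sum_sigma,
    Matrix.submatrix_apply, Equiv.sigmaEquivProd_apply, Matrix.kroneckerMap_apply,
    AugmentedDigraph.F, Matrix.diagonal_mul, Matrix.sub_apply, Matrix.one_apply]
  simp [sub_mul, Finset.sum_sub_distrib, Finset.mul_sum, mul_assoc]

end Stack

section ClosedLoop

variable {N p q : ℕ} {n m nz : Fin N → ℕ}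
  (P : Agents n m p q) (g : AugmentedDigraph N) (c : StateFeedback n m nz p)

/-- The matrix mapping the closed-loop state to the stacked outputs. -/
def outputMatrix : Matrix (Σ _ : Fin N, Fin p) ((Σ i, Fin (n i)) ⊕ (Σ i, Fin (nz i))) ℝ :=
  Matrix.fromCols
    (Matrix.blockDiagonal' P.C + Matrix.blockDiagonal' P.D * Matrix.blockDiagonal' c.K₁)
    (Matrix.blockDiagonal' P.D * Matrix.blockDiagonal' c.K₂)

/-- `N` copies of the reference output matrix. -/
def referenceMatrix : Matrix (Σ _ : Fin N, Fin p) (Fin q) ℝ := Matrix.of fun s => P.R s.2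

/-- The matrix through which the exosystem trajectory enters the closed loop. -/
noncomputable def exosystemInputMatrix : Matrix ((Σ i, Fin (n i)) ⊕ (Σ i, Fin (nz i))) (Fin q) ℝ :=
  Matrix.fromRows (Matrix.of fun s => P.E s.1 s.2)
    (-(Matrix.blockDiagonal' c.G₂ * g.W p * referenceMatrix P))

theorem outputMatrix_mulVec (x : ∀ i, Fin (n i) → ℝ) (z : ∀ i, Fin (nz i) → ℝ) :
    outputMatrix P c *ᵥ Sum.elim (stack x) (stack z) = stack (output P c x z) := by
  rw [outputMatrix, Matrix.fromCols_mulVec_sumElim, Matrix.add_mulVec]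
  simp only [← Matrix.mulVec_mulVec, blockDiagonal'_mulVec_stack, stack_add]
  congr 1
  ext i l
  simp [output, input, Matrix.mulVec_add, add_assoc]

theorem stack_trackingError (x : ∀ i, Fin (n i) → ℝ) (z : ∀ i, Fin (nz i) → ℝ) (w : Fin q → ℝ) :
    stack (trackingError P c x z w) =
      outputMatrix P c *ᵥ Sum.elim (stack x) (stack z) - referenceMatrix P *ᵥ w := by
  rw [outputMatrix_mulVec]
  rfl

variable {g} in
-- The reference cancels in `y_i - y_j = e_i - e_j`, so the weighted sum is `(d_i + k_i) e_i - ∑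
-- a_ij e_j`.
theorem virtualError_eq (hg : g.HasSpanningTreeFromLeader) (x : ∀ i, Fin (n i) → ℝ)
    (z : ∀ i, Fin (nz i) → ℝ) (w : Fin q → ℝ) (i : Fin N) :
    virtualError P g c x z w i = trackingError P c x z w i -
      (1 / (g.d i + g.k i)) • ∑ j, g.a i j • trackingError P c x z w j := by
  have h0 := (hg.d_add_k_pos i).ne'
  have h1 : ∀ j, output P c x z i - output P c x z j =
      trackingError P c x z w i - trackingError P c x z w j := fun j => by
    simp [trackingError]
  have h2 : ∑ j ∈ g.nbrs i, g.a i j • (output P c x z i - output P c x z j) =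
      g.d i • trackingError P c x z w i - ∑ j, g.a i j • trackingError P c x z w j := by
    rw [g.sum_nbrs i (fun j => output P c x z i - output P c x z j), g.d_eq, Finset.sum_smul,
      ← Finset.sum_sub_distrib]
    exact Finset.sum_congr rfl fun j _ => by rw [h1, smul_sub]
  rw [virtualError, h2]
  change _ • (_ + g.k i • trackingError P c x z w i) = _
  rw [sub_add_eq_add_sub, ← add_smul, smul_sub, smul_smul, one_div_mul_cancel h0, one_smul]

variable {g} in
theorem trackingError_eq_zero (hg : g.HasSpanningTreeFromLeader) {x : ∀ i, Fin (n i) → ℝ}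
    {z : ∀ i, Fin (nz i) → ℝ} {w : Fin q → ℝ} (h : virtualError P g c x z w = 0) :
    trackingError P c x z w = 0 := by
  have h1 : ∀ i l, (g.d i + g.k i) * trackingError P c x z w i l =
      ∑ j, g.a i j * trackingError P c x z w j l := by
    intro i l
    have h0 := (hg.d_add_k_pos i).ne'
    have := congrFun (congrFun h i) l
    rw [virtualError_eq P c hg] at this
    simp only [Pi.sub_apply, Pi.smul_apply, Finset.sum_apply, smul_eq_mul, Pi.zero_apply,
      sub_eq_zero] at this
    rw [this, ← mul_assoc, mul_one_div_cancel h0, one_mul]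
  ext i l
  exact congrFun (hg.eq_zero (v := fun i => trackingError P c x z w i l) fun i => h1 i l) i

variable {g} in
-- Stated for arbitrary vectors rather than trajectories, so that it applies both to solutions and
-- to the columns of the Sylvester solution.
theorem closedLoop_rhs (hg : g.HasSpanningTreeFromLeader) (x : ∀ i, Fin (n i) → ℝ)
    (z : ∀ i, Fin (nz i) → ℝ) (w : Fin q → ℝ) :
    closedLoopMatrix P g c *ᵥ Sum.elim (stack x) (stack z) + exosystemInputMatrix P g c *ᵥ w =
      Sum.elim (stack fun i => P.A i *ᵥ x i + P.B i *ᵥ input c x z i + P.E i *ᵥ w)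
        (stack fun i => c.G₁ i *ᵥ z i + c.G₂ i *ᵥ virtualError P g c x z w i) := by
  have hve : stack (virtualError P g c x z w) = g.W p *ᵥ
      (outputMatrix P c *ᵥ Sum.elim (stack x) (stack z) - referenceMatrix P *ᵥ w) := by
    rw [← stack_trackingError, g.W_mulVec_stack]
    exact congrArg stack (funext fun i => virtualError_eq P c hg x z w i)
  have hG : stack (fun i => c.G₁ i *ᵥ z i + c.G₂ i *ᵥ virtualError P g c x z w i) =
      Matrix.blockDiagonal' c.G₁ *ᵥ stack z +
        Matrix.blockDiagonal' c.G₂ *ᵥ stack (virtualError P g c x z w) := by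
    rw [blockDiagonal'_mulVec_stack, blockDiagonal'_mulVec_stack]
    rfl
  have hA : stack (fun i => P.A i *ᵥ x i + P.B i *ᵥ input c x z i + P.E i *ᵥ w) =
      Matrix.blockDiagonal' P.A *ᵥ stack x + Matrix.blockDiagonal' P.B *ᵥ
        (Matrix.blockDiagonal' c.K₁ *ᵥ stack x + Matrix.blockDiagonal' c.K₂ *ᵥ stack z) +
        Matrix.of (fun s : Σ i, Fin (n i) => P.E s.1 s.2) *ᵥ w := by
    simp only [blockDiagonal'_mulVec_stack, stack_add]
    rfl
  rw [hG, hA, hve, outputMatrix, Matrix.fromCols_mulVec_sumElim, closedLoopMatrix,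
    exosystemInputMatrix, Matrix.fromBlocks_mulVec, Matrix.fromRows_mulVec]
  ext (s | s)
  · simp only [Pi.add_apply, Sum.elim_inl, Sum.elim_comp_inl, Sum.elim_comp_inr,
      Matrix.add_mulVec, Matrix.mulVec_add, Matrix.mulVec_mulVec]
    ring
  · simp only [Pi.add_apply, Sum.elim_inr, Sum.elim_comp_inl, Sum.elim_comp_inr,
      Matrix.add_mulVec, Matrix.mulVec_add, Matrix.mulVec_sub, Matrix.mulVec_mulVec,
      Matrix.neg_mulVec, Matrix.mul_assoc, Matrix.mul_add, Pi.sub_apply, Pi.neg_apply]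
    ring

variable {P g c} in
/-- The regulator equations. -/
theorem exists_regulator_solution {A₀ : Matrix (Fin q) (Fin q) ℝ}
    (hA₀ : NoStableEigenvalue A₀) (hg : g.HasSpanningTreeFromLeader)
    (hG : ∀ i, IsInternalModel A₀ (c.G₁ i) (c.G₂ i)) (hH : IsHurwitz (closedLoopMatrix P g c)) :
    ∃ X : Matrix ((Σ i, Fin (n i)) ⊕ (Σ i, Fin (nz i))) (Fin q) ℝ,
      closedLoopMatrix P g c * X + exosystemInputMatrix P g c = X * A₀ ∧
      outputMatrix P c * X = referenceMatrix P := by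
  obtain ⟨X, hX⟩ := exists_sylvester_solution (isCoprime_charpoly hH hA₀)
    (-exosystemInputMatrix P g c)
  have hX' : closedLoopMatrix P g c * X + exosystemInputMatrix P g c = X * A₀ := by
    rw [sub_eq_iff_eq_add] at hX
    rw [hX]; abel
  refine ⟨X, hX', ?_⟩
  -- Column `j` of `X` is read as a closed-loop state belonging to the exosystem value `Pi.single j
  -- 1`.
  let x : Fin q → ∀ i, Fin (n i) → ℝ := fun j i a => X (Sum.inl ⟨i, a⟩) j
  let z : Fin q → ∀ i, Fin (nz i) → ℝ := fun j i a => X (Sum.inr ⟨i, a⟩) j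
  have hcol : ∀ j, Sum.elim (stack (x j)) (stack (z j)) = X *ᵥ Pi.single j 1 := by
    intro j
    rw [Matrix.mulVec_single_one]
    ext (s | s) <;> rfl
  have hve : ∀ i, (Matrix.of fun l j =>
      virtualError P g c (x j) (z j) (Pi.single j 1) i l : Matrix (Fin p) (Fin q) ℝ) = 0 := by
    intro i
    refine (hG i).eq_zero (Z := Matrix.of fun b j => z j i b) ?_
    ext b j
    have h1 := closedLoop_rhs P c hg (x j) (z j) (Pi.single j 1)
    rw [hcol, Matrix.mulVec_mulVec, ← Matrix.add_mulVec, hX', Matrix.mulVec_single_one] at h1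
    exact (congrFun h1 (Sum.inr ⟨i, b⟩)).symm
  have hte : ∀ j, trackingError P c (x j) (z j) (Pi.single j 1) = 0 := by
    intro j
    refine trackingError_eq_zero P c hg ?_
    ext i l
    exact congrFun (congrFun (hve i) l) j
  ext s j
  have h2 := stack_trackingError P c (x j) (z j) (Pi.single j 1)
  rw [hte, hcol, Matrix.mulVec_mulVec, Matrix.mulVec_single_one, Matrix.mulVec_single_one] at h2
  exact (sub_eq_zero.mp (congrFun h2 s).symm)

variable {P g c}

/-- The closed-loop state, as one vector. -/
def closedLoopState (x : ∀ i, ℝ → Fin (n i) → ℝ) (z : ∀ i, ℝ → Fin (nz i) → ℝ) (t : ℝ) :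
    (Σ i, Fin (n i)) ⊕ (Σ i, Fin (nz i)) → ℝ :=
  Sum.elim (stack fun i => x i t) (stack fun i => z i t)

theorem IsClosedLoopSolution.hasDerivWithinAt {ω : ℝ → Fin q → ℝ}
    {x₀ : ∀ i, Fin (n i) → ℝ} {z₀ : ∀ i, Fin (nz i) → ℝ}
    {x : ∀ i, ℝ → Fin (n i) → ℝ} {z : ∀ i, ℝ → Fin (nz i) → ℝ}
    (h : IsClosedLoopSolution P g c ω x₀ z₀ x z) (hg : g.HasSpanningTreeFromLeader)
    {t : ℝ} (ht : 0 ≤ t) :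
    HasDerivWithinAt (closedLoopState x z) (closedLoopMatrix P g c *ᵥ closedLoopState x z t +
      exosystemInputMatrix P g c *ᵥ ω t) (Ici 0) t := by
  rw [closedLoopState, closedLoop_rhs P c hg, hasDerivWithinAt_pi]
  rintro (⟨i, a⟩ | ⟨i, a⟩)
  · exact hasDerivWithinAt_pi.mp (h.x_deriv i t ht) a
  · exact hasDerivWithinAt_pi.mp (h.z_deriv i t ht) a

/-- The Sylvester equation turns `X A₀ ω` into `A_g X ω + B_g ω`, so the exosystem input cancels and
only the mismatch drives the deviation. -/
theorem IsClosedLoopSolution.hasDerivWithinAt_sub {ω : ℝ → Fin q → ℝ}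
    {x₀ : ∀ i, Fin (n i) → ℝ} {z₀ : ∀ i, Fin (nz i) → ℝ}
    {x : ∀ i, ℝ → Fin (n i) → ℝ} {z : ∀ i, ℝ → Fin (nz i) → ℝ}
    (h : IsClosedLoopSolution P g c ω x₀ z₀ x z) (hg : g.HasSpanningTreeFromLeader)
    {A₀ : Matrix (Fin q) (Fin q) ℝ}
    {X : Matrix ((Σ i, Fin (n i)) ⊕ (Σ i, Fin (nz i))) (Fin q) ℝ}
    (hX : closedLoopMatrix P g c * X + exosystemInputMatrix P g c = X * A₀)
    {t : ℝ} (ht : 0 ≤ t) {w' : Fin q → ℝ} (hw : HasDerivWithinAt ω w' (Ici t) t) :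
    HasDerivWithinAt (fun t => closedLoopState x z t - X *ᵥ ω t)
      (closedLoopMatrix P g c *ᵥ (closedLoopState x z t - X *ᵥ ω t) +
        X *ᵥ (A₀ *ᵥ ω t - w')) (Ici t) t := by
  have h1 := (h.hasDerivWithinAt hg ht).mono (Ici_subset_Ici.mpr ht)
  have h2 := (LinearMap.toContinuousLinearMap X.mulVecLin).hasFDerivAt.comp_hasDerivWithinAt t hw
  refine (h1.sub h2).congr_deriv ?_
  have h3 : X *ᵥ A₀ *ᵥ ω t = closedLoopMatrix P g c *ᵥ X *ᵥ ω t +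
      exosystemInputMatrix P g c *ᵥ ω t := by
    rw [Matrix.mulVec_mulVec, ← hX, Matrix.add_mulVec, Matrix.mulVec_mulVec]
  change _ - X *ᵥ w' = _
  rw [Matrix.mulVec_sub, Matrix.mulVec_sub, h3]
  abel

end ClosedLoop

end CoopReg

/-! ### Generalized output regulation -/

theorem theorem1 {N p q : ℕ} {n m nz : Fin N → ℕ}
    (P : CoopReg.Agents n m p q) (g : CoopReg.AugmentedDigraph N)
    (c : CoopReg.StateFeedback n m nz p)
    (A₀ : Matrix (Fin q) (Fin q) ℝ) (ω dω : ℝ → Fin q → ℝ)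
    (hA₀ : CoopReg.NoStableEigenvalue A₀)
    (hω : CoopReg.BoundedMismatch A₀ ω dω)
    (hg : g.HasSpanningTreeFromLeader)
    (hG : ∀ i, CoopReg.IsInternalModel A₀ (c.G₁ i) (c.G₂ i))
    (hH : CoopReg.IsHurwitz (CoopReg.closedLoopMatrix P g c)) :
    CoopReg.SolvesOutputRegulation P g c A₀ ω dω := by
  open CoopReg in
  obtain ⟨hωd, κ, hκ0, hκ⟩ := hω
  obtain ⟨ω', hω'⟩ := hωd.exists_rightDeriv
  obtain ⟨X, hX, hCX⟩ := exists_regulator_solution hA₀ hg hG hH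
  obtain ⟨M, ℓ, hM, hℓ, hest⟩ := hH.exists_norm_le
  set LX := LinearMap.toContinuousLinearMap X.mulVecLin
  have hLX : Continuous fun v : Fin q → ℝ => X *ᵥ v := LX.continuous
  -- the estimate for the deviation from the steady state
  have hdev : ∀ x₀ z₀ x z, IsClosedLoopSolution P g c ω x₀ z₀ x z → ∀ S ε, 0 ≤ S →
      (∀ t, S ≤ t → ‖A₀ *ᵥ ω t - dω t‖ ≤ ε) → ∀ T, S ≤ T →
      ‖closedLoopState x z T - X *ᵥ ω T‖ ≤
        M * Real.exp (-ℓ * (T - S)) * ‖closedLoopState x z S - X *ᵥ ω S‖ +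
          M * (‖LX‖ * ε) := by
    intro x₀ z₀ x z h S ε hS hε
    refine hest (fun t => closedLoopState x z t - X *ᵥ ω t) (fun t => X *ᵥ (A₀ *ᵥ ω t - ω' t))
      S _ ?_ ?_ ?_
    · have h1 : ContinuousOn (closedLoopState x z) (Ici S) := fun t ht =>
        ((h.hasDerivWithinAt hg (hS.trans ht)).continuousWithinAt).mono (Ici_subset_Ici.mpr hS)
      exact h1.sub (hLX.comp_continuousOn (hωd.continuousOn.mono (Ici_subset_Ici.mpr hS)))
    · intro t ht
      exact h.hasDerivWithinAt_sub hg hX (hS.trans ht) (hω' t (hS.trans ht)).1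
    · intro t ht
      refine (LX.le_opNorm _).trans ?_
      gcongr
      exact norm_mismatch_le_of_tendsto hωd.continuousOn hS ht (hω' t (hS.trans ht)).2 hε
  -- the tracking error as a function of the deviation
  have herr : ∀ (x : ∀ i, ℝ → Fin (n i) → ℝ) (z : ∀ i, ℝ → Fin (nz i) → ℝ) t i,
      trackingError P c (fun j => x j t) (fun j => z j t) (ω t) i =
        fun l => (outputMatrix P c *ᵥ (closedLoopState x z t - X *ᵥ ω t)) ⟨i, l⟩ := by
    intro x z t i
    rw [Matrix.mulVec_sub, Matrix.mulVec_mulVec, hCX, closedLoopState, ← stack_trackingError]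
    rfl
  let Le : Fin N → ((Σ i, Fin (n i)) ⊕ (Σ i, Fin (nz i)) → ℝ) →L[ℝ] (Fin p → ℝ) := fun i =>
    ContinuousLinearMap.pi fun l => (ContinuousLinearMap.proj (⟨i, l⟩ : Σ _ : Fin N, Fin p)).comp
      (LinearMap.toContinuousLinearMap (outputMatrix P c).mulVecLin)
  have herr' : ∀ (x : ∀ i, ℝ → Fin (n i) → ℝ) (z : ∀ i, ℝ → Fin (nz i) → ℝ) t i,
      trackingError P c (fun j => x j t) (fun j => z j t) (ω t) i =
        Le i (closedLoopState x z t - X *ᵥ ω t) := herr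
  refine ⟨hH, ?_, ?_⟩
  · let L2 : (Fin p → ℝ) →L[ℝ] EuclideanSpace ℝ (Fin p) :=
      (PiLp.continuousLinearEquiv 2 ℝ (fun _ : Fin p => ℝ)).symm.toContinuousLinearMap
    set K := ∑ i, ‖L2.comp (Le i)‖ with hK
    have hK0 : 0 ≤ K := Finset.sum_nonneg fun i _ => norm_nonneg _
    have hsup : ∀ t, 0 ≤ t → ‖A₀ *ᵥ ω t - dω t‖ ≤ κ := fun t ht => by
      refine le_trans ?_ (hκ t ht)
      exact (pi_norm_le_iff_of_nonneg (norm_nonneg _)).mpr fun k =>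
        PiLp.norm_apply_le (WithLp.toLp 2 (A₀ *ᵥ ω t - dω t)) k
    -- The inner `1` bounds the transient after time `T`, which depends only on the initial data;
    -- the final `+ 1` makes the bound positive.
    refine ⟨K * (1 + M * (‖LX‖ * κ)) + 1, by positivity, fun x₀ z₀ => ?_⟩
    set r := ‖Sum.elim (stack x₀) (stack z₀) - X *ᵥ ω 0‖ with hr
    have hlim : Tendsto (fun T : ℝ => M * Real.exp (-ℓ * (T - 0)) * r) atTop (𝓝 0) := by
      have h1 : Tendsto (fun T : ℝ => -ℓ * (T - 0)) atTop atBot := by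
        simpa using tendsto_id.const_mul_atTop_of_neg (neg_neg_of_pos hℓ)
      simpa using ((Real.tendsto_exp_atBot.comp h1).const_mul M).mul_const r
    obtain ⟨T, hT⟩ := eventually_atTop.mp (hlim.eventually_le_const one_pos)
    refine ⟨max T 0, le_max_right _ _, fun x z h t ht i => ?_⟩
    have h0 : closedLoopState x z 0 = Sum.elim (stack x₀) (stack z₀) := by
      simp only [closedLoopState, h.x_init, h.z_init]
    have h1 := hdev x₀ z₀ x z h 0 κ le_rfl hsup t ((le_max_right _ _).trans ht)
    rw [h0, ← hr] at h1
    have h2 := hT t ((le_max_left _ _).trans ht)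
    rw [herr']
    have h3 : ‖L2.comp (Le i)‖ ≤ K :=
      Finset.single_le_sum (f := fun i => ‖L2.comp (Le i)‖) (fun i _ => norm_nonneg _)
        (Finset.mem_univ i)
    calc ‖WithLp.toLp 2 (Le i (closedLoopState x z t - X *ᵥ ω t))‖
        ≤ ‖L2.comp (Le i)‖ * ‖closedLoopState x z t - X *ᵥ ω t‖ :=
          (L2.comp (Le i)).le_opNorm _
      _ ≤ K * (1 + M * (‖LX‖ * κ)) := by
          gcongr
          linarith
      _ ≤ _ := by linarith
  · intro hlim x₀ z₀ x z h i
    have hzero : Tendsto (fun t => closedLoopState x z t - X *ᵥ ω t) atTop (𝓝 0) := by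
      rw [Metric.tendsto_atTop]
      intro η hη
      set ε := η / (2 * (M * ‖LX‖ + 1)) with hε
      have hε0 : 0 < ε := by positivity
      have hεη : M * (‖LX‖ * ε) ≤ η / 2 := by
        rw [hε, ← mul_assoc, mul_div_assoc', div_le_div_iff₀ (by positivity) two_pos]
        nlinarith [mul_nonneg hM (norm_nonneg LX)]
      obtain ⟨S₀, hS₀⟩ := eventually_atTop.mp (hlim.norm.eventually_le_const (by simpa using hε0))
      -- Restarting the estimate at `S`, after which the mismatch is at most `ε`, leaves a forcing
      -- term of at most `η / 2` and a transient that still decays.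
      set S := max S₀ 0
      have h1 := hdev x₀ z₀ x z h S ε (le_max_right _ _)
        fun t ht => hS₀ t ((le_max_left _ _).trans ht)
      have h2 : Tendsto (fun T : ℝ => M * Real.exp (-ℓ * (T - S)) *
          ‖closedLoopState x z S - X *ᵥ ω S‖) atTop (𝓝 0) := by
        have h3 : Tendsto (fun T : ℝ => -ℓ * (T - S)) atTop atBot :=
          (tendsto_atTop_add_const_right _ (-S) tendsto_id).const_mul_atTop_of_neg
            (neg_neg_of_pos hℓ)
        simpa using ((Real.tendsto_exp_atBot.comp h3).const_mul M).mul_const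
          ‖closedLoopState x z S - X *ᵥ ω S‖
      obtain ⟨T, hT⟩ := eventually_atTop.mp (h2.eventually_lt_const (half_pos hη))
      refine ⟨max T S, fun t ht => ?_⟩
      rw [dist_zero_right]
      have h4 := h1 t ((le_max_right _ _).trans ht)
      have h5 := hT t ((le_max_left _ _).trans ht)
      linarith
    have := ((Le i).continuous.tendsto 0).comp hzero
    rw [map_zero] at this
    exact this.congr fun t => (herr' x z t i).symm
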